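/- Let $n\ge 0$, let $f\colon\{0,1\}^n\to\{0,1\}$ and let ${\sf col}\colon E(\{0,1\}^n)\to\{{\sf red},{\sf blue}\}$ be a $2$-coloring of the edges of the hypercube (the unordered pairs $\{x,x\oplus e_i\}$). An edge $\{x,x\oplus e_i\}$ is sensitive if $f(x)\ne f(x\oplus e_i)$. Let $s_{f,{\sf red}}(x)$ be $0$ if $f(x)=0$, and otherwise the number of red sensitive edges at $x$; let $s_{f,{\sf blue}}(x)$ be $0$ if $f(x)=1$, and otherwise the number of blue sensitive edges at $x$. With $x$ uniform in $\{0,1\}^n$ put $${\sf Talagrand}_{\sf col}(f)=\mathbb{E}_x\sqrt{s_{f,{\sf red}}(x)}+\mathbb{E}_x\sqrt{s_{f,{\sf blue}}(x)},$$ $\widehat f(S)=\mathbb{E}_x\big[f(x)\prod_{i\in S}(-1)^{x_i}\big]$, $W_{=d}[f]=\sum_{|S|=d}\widehat f(S)^2$, $W_{\ge d}[f]=\sum_{|S|\ge d}\widehat f(S)^2$, $I_i[f]=\Pr_x[f(x)\ne f(x\oplus e_i)]$, and let ${\sf var}(f)$ be the variance of $f(x)$. Then, for all $n$, $f$ and ${\sf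 col}$: 1. ${\sf Talagrand}_{\sf col}(f)\ge \frac12\sqrt{W_{=1}[f]}$. Moreover there is an absolute constant $c>0$ such that, for all $n$, $f$ and ${\sf col}$: 2. ${\sf Talagrand}_{\sf col}(f)\ge c\,\sqrt d\;W_{\ge d}[f]$ for every $d\in\mathbb{N}$; 3. ${\sf Talagrand}_{\sf col}(f)\ge c\;{\sf var}(f)\sqrt{\log(1/{\sf var}(f))}$; 4. ${\sf Talagrand}_{\sf col}(f)\ge c\;{\sf var}(f)\sqrt{\log\Big(1+\frac{1}{\sum_{i=1}^n I_i[f]^2}\Big)}$. In 3 and 4 the right-hand side is read as $0$ when ${\sf var}(f)=0$, i.e. when $f$ is constant. -/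

import Mathlib

open scoped BigOperators

/-- The vertex set `{0,1}^n` of the hypercube. -/
abbrev Cube (n : ℕ) : Type := Fin n → Bool

/-- The hypercube graph: two points are adjacent iff they differ in exactly one coordinate. -/
def cubeGraph (n : ℕ) : SimpleGraph (Cube n) where
  Adj x y := hammingDist x y = 1
  symm := ⟨fun x y h => by rw [hammingDist_comm]; exact h⟩
  loopless := ⟨fun x h => by simp at h⟩

/-- `x ⊕ e_i`. -/
def flipAt {n : ℕ} (x : Cube n) (i : Fin n) : Cube n := Function.update x i (!x i)

theorem cubeGraph_adj_flipAt {n : ℕ} (x : Cube n) (i : Fin n) :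
    (cubeGraph n).Adj x (flipAt x i) := by
  have h : (Finset.univ.filter fun j => x j ≠ flipAt x i j) = {i} := by
    ext j
    rw [Finset.mem_filter, Finset.mem_singleton]
    by_cases hj : j = i
    · subst hj; simp [flipAt]
    · simp [flipAt, hj]
  change (Finset.univ.filter fun j => x j ≠ flipAt x i j).card = 1
  rw [h, Finset.card_singleton]

/-- The (undirected) edge `{x, x ⊕ e_i}` of the hypercube. -/
def edgeAt {n : ℕ} (x : Cube n) (i : Fin n) : (cubeGraph n).edgeSet :=
  ⟨s(x, flipAt x i), (SimpleGraph.mem_edgeSet _).2 (cubeGraph_adj_flipAt x i)⟩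

/-- The two colors. -/
inductive EdgeColor : Type
  | red : EdgeColor
  | blue : EdgeColor

/-- A 2-coloring of the edges of the hypercube. -/
abbrev EdgeColoring (n : ℕ) : Type := (cubeGraph n).edgeSet → EdgeColor

noncomputable section

/-- A Boolean function, regarded as a real-valued function with values `0` and `1`. -/
def boolToReal {n : ℕ} (f : Cube n → Bool) (x : Cube n) : ℝ := if f x = true then 1 else 0

/-- The character `χ_S(x) = ∏_{i ∈ S} (-1)^{x_i}`. -/
def chi {n : ℕ} (S : Finset (Fin n)) (x : Cube n) : ℝ :=
  ∏ i ∈ S, (if x i = true then (-1 : ℝ) else 1)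

/-- The Fourier coefficient `E_x [f(x) χ_S(x)]`, for `x` uniform in `{0,1}^n`. -/
def cubeFourier {n : ℕ} (f : Cube n → ℝ) (S : Finset (Fin n)) : ℝ :=
  𝔼 x : Cube n, f x * chi S x

/-- The level `d` Fourier weight `W_{=d}[f]`. -/
def weightEq {n : ℕ} (d : ℕ) (f : Cube n → ℝ) : ℝ :=
  ∑ S : Finset (Fin n) with S.card = d, cubeFourier f S ^ 2

/-- The Fourier weight `W_{≥d}[f]` at levels at least `d`. -/
def weightGe {n : ℕ} (d : ℕ) (f : Cube n → ℝ) : ℝ :=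
  ∑ S : Finset (Fin n) with d ≤ S.card, cubeFourier f S ^ 2

/-- The variance of `f(x)` for `x` uniform in `{0,1}^n`. -/
def cubeVar {n : ℕ} (f : Cube n → ℝ) : ℝ :=
  𝔼 x : Cube n, (f x - 𝔼 y : Cube n, f y) ^ 2

/-- The influence `I_i[f] = Pr_x [f(x) ≠ f(x ⊕ e_i)]`. -/
def influence {n : ℕ} (f : Cube n → Bool) (i : Fin n) : ℝ :=
  𝔼 x : Cube n, (if f x ≠ f (flipAt x i) then (1 : ℝ) else 0)

open Classical in
/-- The red sensitivity: `0` if `f(x) = 0`, otherwise the number of red sensitive edges at `x`. -/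
def redSens {n : ℕ} (col : EdgeColoring n) (f : Cube n → Bool) (x : Cube n) : ℕ :=
  if f x = false then 0 else
    (Finset.univ.filter fun i : Fin n =>
      f (flipAt x i) ≠ f x ∧ col (edgeAt x i) = EdgeColor.red).card

open Classical in
/-- The blue sensitivity: `0` if `f(x) = 1`, otherwise the number of blue sensitive edges at `x`. -/
def blueSens {n : ℕ} (col : EdgeColoring n) (f : Cube n → Bool) (x : Cube n) : ℕ :=
  if f x = true then 0 else
    (Finset.univ.filter fun i : Fin n =>
      f (flipAt x i) ≠ f x ∧ col (edgeAt x i) = EdgeColor.blue).card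

/-- `Talagrand_col(f) = E_x √(s_{f,red}(x)) + E_x √(s_{f,blue}(x))`. -/
def talagrandCol {n : ℕ} (col : EdgeColoring n) (f : Cube n → Bool) : ℝ :=
  (𝔼 x : Cube n, Real.sqrt (redSens col f x : ℝ)) +
    𝔼 x : Cube n, Real.sqrt (blueSens col f x : ℝ)

end

/-! Charge every sensitive edge to exactly one of its endpoints: the one of value `1` if the edge is
red, the one of value `0` if it is blue. The Talagrand functional is then `𝔼 √(number of charges)`.
Since `L_i f` is odd in direction `i`, the pairing `𝔼 L_i f · h_i` with another odd function can be
computed from the charged endpoints alone, so by Cauchy–Schwarz `∑ i, 𝔼 L_i f · h_i` is at most `B`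
times the Talagrand functional as soon as `∑ i, h_i ^ 2 ≤ B ^ 2` pointwise.

Taking for `h_i` the level one part of `L_i f` gives the first bound. For the others take
`h_i = √(1 - ρ ^ 2) T_ρ L_i f`: in the space `L²` of the noise density at `x`, the numbers
`T_ρ L_i f (x)` are up to scaling the coefficients of `f` along the orthogonal coordinate functions,
so Bessel's inequality bounds `∑ i, h_i ^ 2`. Integrating the result along `ρ = cos θ` shows that
the variance exceeds the noise covariance at `cos θ` by at most `θ` times the Talagrand functional,
and `θ = 1 / √d` yields the Fourier tail bound. The logarithmic bounds follow by choosing `d`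
so that half of the variance lies above level `d`; a large such `d` exists by hypercontractivity,
which bounds the noise covariance by `var ^ (3 / 2)` and by `√(∑ i, I_i ^ 2)`. -/

section CubeAnalysis

open Finset

variable {n : ℕ}

/-! ### Characters and Fourier inversion -/

theorem flipAt_apply_self (x : Cube n) (i : Fin n) : flipAt x i i = !x i :=
  Function.update_self i _ x

theorem flipAt_apply_of_ne (x : Cube n) {i j : Fin n} (h : j ≠ i) : flipAt x i j = x j :=
  Function.update_of_ne h _ x

theorem flipAt_flipAt (x : Cube n) (i : Fin n) : flipAt (flipAt x i) i = x := by
  simp [flipAt]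

theorem edgeAt_flipAt (x : Cube n) (i : Fin n) : edgeAt (flipAt x i) i = edgeAt x i := by
  apply Subtype.ext
  simp only [edgeAt, flipAt_flipAt]
  exact Sym2.eq_swap

theorem expect_flipAt (g : Cube n → ℝ) (i : Fin n) :
    𝔼 x : Cube n, g (flipAt x i) = 𝔼 x, g x :=
  Fintype.expect_equiv
    (Function.Involutive.toPerm (flipAt · i) fun x => flipAt_flipAt x i) _ _ fun _ => rfl

theorem expect_eq_zero_of_flipAt_eq_neg {g : Cube n → ℝ} {i : Fin n}
    (h : ∀ x, g (flipAt x i) = -g x) : 𝔼 x, g x = 0 := by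
  have h_neg := expect_flipAt g i
  simp only [h, expect_neg_distrib] at h_neg
  linarith

theorem chi_empty (x : Cube n) : chi ∅ x = 1 :=
  prod_empty

theorem chi_insert {S : Finset (Fin n)} {i : Fin n} (h : i ∉ S) (x : Cube n) :
    chi (insert i S) x = chi {i} x * chi S x := by
  simp only [chi, prod_insert h, prod_singleton]

theorem chi_flipAt_of_notMem {S : Finset (Fin n)} {i : Fin n} (h : i ∉ S) (x : Cube n) :
    chi S (flipAt x i) = chi S x :=
  prod_congr rfl fun j hj => by rw [flipAt_apply_of_ne x (ne_of_mem_of_not_mem hj h)]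

theorem chi_singleton_flipAt (x : Cube n) (i : Fin n) : chi {i} (flipAt x i) = -chi {i} x := by
  simp only [chi, prod_singleton, flipAt_apply_self]
  cases x i <;> simp

theorem chi_flipAt_of_mem {S : Finset (Fin n)} {i : Fin n} (h : i ∈ S) (x : Cube n) :
    chi S (flipAt x i) = -chi S x := by
  rw [← insert_erase h, chi_insert (notMem_erase i S), chi_insert (notMem_erase i S),
    chi_singleton_flipAt, chi_flipAt_of_notMem (notMem_erase i S), neg_mul]

theorem chi_mul_self (S : Finset (Fin n)) (x : Cube n) : chi S x * chi S x = 1 := by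
  rw [chi, ← prod_mul_distrib]
  exact prod_eq_one fun i _ => by split_ifs <;> norm_num

theorem chi_sq (S : Finset (Fin n)) (x : Cube n) : chi S x ^ 2 = 1 := by
  rw [sq, chi_mul_self]

theorem expect_chi_mul_chi (S T : Finset (Fin n)) :
    𝔼 x : Cube n, chi S x * chi T x = if S = T then 1 else 0 := by
  split_ifs with hST
  · subst hST
    simp only [chi_mul_self]
    exact Fintype.expect_const 1
  · obtain ⟨i, hi⟩ : ∃ i, ¬(i ∈ S ↔ i ∈ T) := by
      by_contra! h
      exact hST (Finset.ext h)
    refine expect_eq_zero_of_flipAt_eq_neg (i := i) fun x => ?_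
    by_cases hS : i ∈ S
    · have hT : i ∉ T := fun hT => hi ⟨fun _ => hT, fun _ => hS⟩
      rw [chi_flipAt_of_mem hS, chi_flipAt_of_notMem hT, neg_mul]
    · have hT : i ∈ T := by tauto
      rw [chi_flipAt_of_notMem hS, chi_flipAt_of_mem hT, mul_neg]

theorem cubeFourier_chi (S T : Finset (Fin n)) :
    cubeFourier (chi S) T = if S = T then 1 else 0 :=
  expect_chi_mul_chi S T

theorem cubeFourier_empty (g : Cube n → ℝ) : cubeFourier g ∅ = 𝔼 x, g x := by
  simp only [cubeFourier, chi_empty, mul_one]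

theorem cubeFourier_sub (g h : Cube n → ℝ) (S : Finset (Fin n)) :
    cubeFourier (fun x => g x - h x) S = cubeFourier g S - cubeFourier h S := by
  simp only [cubeFourier, sub_mul, expect_sub_distrib]

theorem cubeFourier_sum_chi (a : Finset (Fin n) → ℝ) (T : Finset (Fin n)) :
    cubeFourier (fun x => ∑ S, a S * chi S x) T = a T := by
  calc cubeFourier (fun x => ∑ S, a S * chi S x) T
      = ∑ S, a S * cubeFourier (chi S) T := by
        simp only [cubeFourier, sum_mul, mul_assoc, expect_sum_comm, mul_expect]
    _ = a T := by simp [cubeFourier_chi]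

/-- The density with respect to the uniform measure, as a function of `y`, of the random point whose
coordinates are independent and `ρ`-correlated with those of `x`. -/
noncomputable def noiseKernel (ρ : ℝ) (x y : Cube n) : ℝ :=
  ∏ i, (1 + ρ * (chi {i} x * chi {i} y))

theorem noiseKernel_eq_sum (ρ : ℝ) (x y : Cube n) :
    noiseKernel ρ x y = ∑ S : Finset (Fin n), ρ ^ #S * (chi S x * chi S y) := by
  rw [noiseKernel, prod_one_add, powerset_univ]
  refine sum_congr rfl fun S _ => ?_
  simp only [prod_mul_distrib, prod_const, chi, prod_singleton]

theorem sum_chi_mul_chi (x y : Cube n) :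
    ∑ S : Finset (Fin n), chi S x * chi S y = if x = y then 2 ^ n else 0 := by
  have h_kernel := noiseKernel_eq_sum 1 x y
  simp only [one_pow, one_mul] at h_kernel
  rw [← h_kernel, noiseKernel]
  split_ifs with hxy
  · simp [hxy, chi_mul_self, one_add_one_eq_two]
  · obtain ⟨i, hi⟩ := Function.ne_iff.1 hxy
    refine prod_eq_zero (mem_univ i) ?_
    cases hx : x i <;> cases hy : y i <;> simp_all [chi]

theorem sum_cubeFourier_mul_chi (g : Cube n → ℝ) (x : Cube n) :
    ∑ S, cubeFourier g S * chi S x = g x := by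
  calc ∑ S, cubeFourier g S * chi S x
      = 𝔼 y, g y * ∑ S, chi S y * chi S x := by
        simp only [cubeFourier, expect_mul, mul_sum, expect_sum_comm, mul_assoc]
    _ = g x := by
        rw [Fintype.expect_eq_sum_div_card]
        simp [sum_chi_mul_chi]

theorem expect_mul_eq_sum_cubeFourier (g h : Cube n → ℝ) :
    𝔼 x, g x * h x = ∑ S, cubeFourier g S * cubeFourier h S := by
  calc 𝔼 x, g x * h x = 𝔼 x, ∑ S, cubeFourier g S * (h x * chi S x) := by
        refine expect_congr rfl fun x _ => ?_
        rw [← sum_cubeFourier_mul_chi g x, sum_mul]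
        exact sum_congr rfl fun S _ => by ring
    _ = ∑ S, cubeFourier g S * cubeFourier h S := by
        simp only [expect_sum_comm, ← mul_expect, cubeFourier]

theorem expect_sq_eq_sum_cubeFourier_sq (g : Cube n → ℝ) :
    𝔼 x, g x ^ 2 = ∑ S, cubeFourier g S ^ 2 := by
  simp only [sq, expect_mul_eq_sum_cubeFourier]

theorem cubeFourier_sub_expect (g : Cube n → ℝ) (S : Finset (Fin n)) :
    cubeFourier (fun x => g x - 𝔼 y, g y) S = if S.Nonempty then cubeFourier g S else 0 := by
  have h_const : cubeFourier (fun _ => 𝔼 y, g y) S = if S = ∅ then 𝔼 y, g y else 0 := by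
    have h_one : 𝔼 x : Cube n, chi S x = if S = ∅ then 1 else 0 := by
      simpa [chi_empty] using expect_chi_mul_chi S ∅
    rw [cubeFourier, ← mul_expect, h_one, mul_ite, mul_one, mul_zero]
  rw [cubeFourier_sub, h_const]
  rcases S.eq_empty_or_nonempty with rfl | hS
  · simp [cubeFourier_empty]
  · simp [hS, hS.ne_empty]

theorem cubeVar_eq_sum (g : Cube n → ℝ) :
    cubeVar g = ∑ S with S.Nonempty, cubeFourier g S ^ 2 := by
  rw [cubeVar, expect_sq_eq_sum_cubeFourier_sq, sum_filter]
  exact sum_congr rfl fun S _ => by rw [cubeFourier_sub_expect]; split_ifs <;> simp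

theorem cubeVar_nonneg (g : Cube n → ℝ) : 0 ≤ cubeVar g :=
  expect_nonneg fun _ _ => sq_nonneg _

theorem weightGe_one (g : Cube n → ℝ) : weightGe 1 g = cubeVar g := by
  simp only [weightGe, cubeVar_eq_sum, one_le_card]

theorem weightEq_one (g : Cube n → ℝ) : weightEq 1 g = ∑ i, cubeFourier g {i} ^ 2 := by
  rw [weightEq, univ_filter_card_eq, powersetCard_one, sum_map]
  rfl

/-! ### The noise operator -/

theorem noiseKernel_nonneg {ρ : ℝ} (hρ : |ρ| ≤ 1) (x y : Cube n) : 0 ≤ noiseKernel ρ x y := by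
  refine prod_nonneg fun i _ => ?_
  obtain ⟨h_lower, h_upper⟩ := abs_le.1 hρ
  have h_sign : chi {i} x * chi {i} y = 1 ∨ chi {i} x * chi {i} y = -1 := by
    rw [← sq_eq_one_iff, mul_pow, chi_sq, chi_sq, one_mul]
  rcases h_sign with h | h <;> rw [h] <;> linarith

theorem noiseKernel_comm (ρ : ℝ) (x y : Cube n) : noiseKernel ρ x y = noiseKernel ρ y x := by
  simp only [noiseKernel, mul_comm (chi _ x)]

/-- The noise operator `T_ρ`: averaging over a `ρ`-correlated copy of `x`. -/
noncomputable def noiseOp (ρ : ℝ) (g : Cube n → ℝ) (x : Cube n) : ℝ :=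
  𝔼 y, noiseKernel ρ x y * g y

theorem noiseOp_eq_sum (ρ : ℝ) (g : Cube n → ℝ) (x : Cube n) :
    noiseOp ρ g x = ∑ S, ρ ^ #S * cubeFourier g S * chi S x := by
  simp only [noiseOp, noiseKernel_eq_sum, sum_mul, expect_sum_comm, cubeFourier, mul_expect,
    expect_mul]
  exact sum_congr rfl fun S _ => expect_congr rfl fun y _ => by ring

theorem cubeFourier_noiseOp (ρ : ℝ) (g : Cube n → ℝ) (S : Finset (Fin n)) :
    cubeFourier (noiseOp ρ g) S = ρ ^ #S * cubeFourier g S := by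
  rw [← cubeFourier_sum_chi (fun S => ρ ^ #S * cubeFourier g S)]
  exact congrArg (cubeFourier · S) (funext (noiseOp_eq_sum ρ g))

theorem noiseOp_chi (ρ : ℝ) (S : Finset (Fin n)) (x : Cube n) :
    noiseOp ρ (chi S) x = ρ ^ #S * chi S x := by
  simp [noiseOp_eq_sum, cubeFourier_chi]

theorem expect_noiseKernel (ρ : ℝ) (x : Cube n) : 𝔼 y, noiseKernel ρ x y = 1 := by
  simpa [noiseOp, chi_empty] using noiseOp_chi ρ ∅ x

theorem noiseOp_mono {ρ : ℝ} (hρ : |ρ| ≤ 1) {g h : Cube n → ℝ} (hgh : ∀ x, g x ≤ h x)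
    (x : Cube n) : noiseOp ρ g x ≤ noiseOp ρ h x :=
  expect_le_expect fun y _ => mul_le_mul_of_nonneg_left (hgh y) (noiseKernel_nonneg hρ x y)

theorem noiseOp_const (ρ c : ℝ) (x : Cube n) : noiseOp ρ (fun _ => c) x = c := by
  rw [noiseOp, ← expect_mul, expect_noiseKernel, one_mul]

theorem expect_abs_noiseOp_le {ρ : ℝ} (hρ : |ρ| ≤ 1) (g : Cube n → ℝ) :
    𝔼 x, |noiseOp ρ g x| ≤ 𝔼 x, |g x| := by
  calc 𝔼 x, |noiseOp ρ g x| ≤ 𝔼 x, 𝔼 y, noiseKernel ρ x y * |g y| := by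
        refine expect_le_expect fun x _ => (abs_expect_le _ _).trans_eq ?_
        exact expect_congr rfl fun y _ => by rw [abs_mul, abs_of_nonneg (noiseKernel_nonneg hρ x y)]
    _ = 𝔼 y, (𝔼 x, noiseKernel ρ y x) * |g y| := by
        rw [expect_comm]
        simp only [expect_mul, noiseKernel_comm]
    _ = 𝔼 x, |g x| := by simp only [expect_noiseKernel, one_mul]

/-- The noise stability `⟨g, T_ρ g⟩`. -/
noncomputable def noiseStab (ρ : ℝ) (g : Cube n → ℝ) : ℝ :=
  𝔼 x, g x * noiseOp ρ g x

theorem noiseStab_eq_sum (ρ : ℝ) (g : Cube n → ℝ) :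
    noiseStab ρ g = ∑ S, ρ ^ #S * cubeFourier g S ^ 2 := by
  rw [noiseStab, expect_mul_eq_sum_cubeFourier]
  exact sum_congr rfl fun S _ => by rw [cubeFourier_noiseOp]; ring

theorem noiseStab_nonneg {ρ : ℝ} (hρ : 0 ≤ ρ) (g : Cube n → ℝ) : 0 ≤ noiseStab ρ g := by
  rw [noiseStab_eq_sum]
  positivity

theorem noiseStab_noiseOp (ρ σ : ℝ) (g : Cube n → ℝ) :
    noiseStab ρ (noiseOp σ g) = noiseStab (ρ * σ ^ 2) g := by
  simp only [noiseStab_eq_sum, cubeFourier_noiseOp]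
  exact sum_congr rfl fun S _ => by ring

theorem expect_noiseOp_sq (σ : ℝ) (g : Cube n → ℝ) :
    𝔼 x, noiseOp σ g x ^ 2 = noiseStab (σ ^ 2) g := by
  simp only [expect_sq_eq_sum_cubeFourier_sq, noiseStab_eq_sum, cubeFourier_noiseOp]
  exact sum_congr rfl fun S _ => by ring

/-- The covariance of `g` at a pair of `ρ`-correlated points. -/
noncomputable def noiseCov (ρ : ℝ) (g : Cube n → ℝ) : ℝ :=
  noiseStab ρ fun x => g x - 𝔼 y, g y

theorem noiseCov_eq_sum (ρ : ℝ) (g : Cube n → ℝ) :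
    noiseCov ρ g = ∑ S with S.Nonempty, ρ ^ #S * cubeFourier g S ^ 2 := by
  rw [noiseCov, noiseStab_eq_sum, sum_filter]
  exact sum_congr rfl fun S _ => by rw [cubeFourier_sub_expect]; split_ifs <;> simp

/-! ### Coordinate Laplacians and the noisy gradient bound -/

/-- The coordinate Laplacian `L_i g`, the part of the Fourier expansion of `g` indexed by the sets
containing `i`. -/
noncomputable def cubeLap (i : Fin n) (g : Cube n → ℝ) (x : Cube n) : ℝ :=
  (g x - g (flipAt x i)) / 2

theorem cubeLap_flipAt (i : Fin n) (g : Cube n → ℝ) (x : Cube n) :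
    cubeLap i g (flipAt x i) = -cubeLap i g x := by
  rw [cubeLap, cubeLap, flipAt_flipAt]
  ring

theorem cubeFourier_cubeLap (i : Fin n) (g : Cube n → ℝ) (S : Finset (Fin n)) :
    cubeFourier (cubeLap i g) S = if i ∈ S then cubeFourier g S else 0 := by
  have h_flip := expect_flipAt (fun x => g x * chi S (flipAt x i)) i
  simp only [flipAt_flipAt] at h_flip
  have h_expand : cubeFourier (cubeLap i g) S =
      (cubeFourier g S - 𝔼 x, g x * chi S (flipAt x i)) / 2 := by
    rw [← h_flip, cubeFourier, cubeFourier, ← expect_sub_distrib, expect_div]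
    exact expect_congr rfl fun x _ => by rw [cubeLap]; ring
  rw [h_expand]
  split_ifs with hi
  · simp only [chi_flipAt_of_mem hi, mul_neg, expect_neg_distrib, cubeFourier]
    ring
  · simp only [chi_flipAt_of_notMem hi, cubeFourier, sub_self, zero_div]

theorem noiseOp_cubeLap_flipAt (ρ : ℝ) (i : Fin n) (g : Cube n → ℝ) (x : Cube n) :
    noiseOp ρ (cubeLap i g) (flipAt x i) = -noiseOp ρ (cubeLap i g) x := by
  simp only [noiseOp_eq_sum, cubeFourier_cubeLap, ← sum_neg_distrib]
  refine sum_congr rfl fun S _ => ?_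
  by_cases hi : i ∈ S
  · rw [chi_flipAt_of_mem hi, mul_neg]
  · simp [hi]

theorem sum_noiseStab_cubeLap (ρ : ℝ) (g : Cube n → ℝ) :
    ∑ i, noiseStab ρ (cubeLap i g) = ∑ S, #S * ρ ^ #S * cubeFourier g S ^ 2 := by
  simp only [noiseStab_eq_sum]
  rw [sum_comm]
  refine sum_congr rfl fun S _ => ?_
  simp only [cubeFourier_cubeLap, ite_pow, mul_ite, zero_pow two_ne_zero, mul_zero, sum_ite_mem,
    univ_inter, sum_const, nsmul_eq_mul, mul_assoc]

theorem noiseCov_le_sum_noiseStab_cubeLap {ρ : ℝ} (hρ : 0 ≤ ρ) (g : Cube n → ℝ) :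
    noiseCov ρ g ≤ ∑ i, noiseStab ρ (cubeLap i g) := by
  rw [noiseCov_eq_sum, sum_noiseStab_cubeLap, sum_filter]
  refine sum_le_sum fun S _ => ?_
  split_ifs with hS
  · have h_card : (1 : ℝ) ≤ #S := by exact_mod_cast hS.card_pos
    have h_term : 0 ≤ ρ ^ #S * cubeFourier g S ^ 2 := by positivity
    nlinarith
  · positivity

theorem noiseKernel_flipAt (ρ : ℝ) (x y : Cube n) (i : Fin n) :
    (1 - ρ ^ 2) * noiseKernel ρ x (flipAt y i) =
      (1 - 2 * ρ * (chi {i} x * chi {i} y) + ρ ^ 2) * noiseKernel ρ x y := by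
  have h_rest : ∏ j ∈ univ.erase i, (1 + ρ * (chi {j} x * chi {j} (flipAt y i))) =
      ∏ j ∈ univ.erase i, (1 + ρ * (chi {j} x * chi {j} y)) :=
    prod_congr rfl fun j hj => by
      rw [chi_flipAt_of_notMem (by simpa using (ne_of_mem_erase hj).symm)]
  have h_sq : (chi {i} x * chi {i} y) ^ 2 = 1 := by rw [mul_pow, chi_sq, chi_sq, one_mul]
  rw [noiseKernel, noiseKernel, ← mul_prod_erase univ _ (mem_univ i),
    ← mul_prod_erase univ (fun j => 1 + ρ * (chi {j} x * chi {j} y)) (mem_univ i), h_rest,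
    chi_singleton_flipAt]
  linear_combination (2 * ρ ^ 2 * ∏ j ∈ univ.erase i, (1 + ρ * (chi {j} x * chi {j} y))) * h_sq

theorem noiseOp_cubeLap (ρ : ℝ) (i : Fin n) (g : Cube n → ℝ) (x : Cube n) :
    (1 - ρ ^ 2) * noiseOp ρ (cubeLap i g) x =
      ρ * 𝔼 y, noiseKernel ρ x y * (g y * (chi {i} x * chi {i} y - ρ)) := by
  have h_flip := expect_flipAt (fun y => noiseKernel ρ x (flipAt y i) * g y) i
  simp only [flipAt_flipAt] at h_flip
  calc (1 - ρ ^ 2) * noiseOp ρ (cubeLap i g) x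
      = (1 - ρ ^ 2) * (𝔼 y, noiseKernel ρ x y * g y -
          𝔼 y, noiseKernel ρ x (flipAt y i) * g y) / 2 := by
        rw [← h_flip, ← expect_sub_distrib, noiseOp, mul_div_assoc, expect_div]
        congr 1
        exact expect_congr rfl fun y _ => by rw [cubeLap]; ring
    _ = ρ * 𝔼 y, noiseKernel ρ x y * (g y * (chi {i} x * chi {i} y - ρ)) := by
        rw [← expect_sub_distrib, mul_expect, expect_div, mul_expect]
        refine expect_congr rfl fun y _ => ?_
        linear_combination (-g y / 2) * noiseKernel_flipAt ρ x y i

theorem expect_noiseKernel_mul_chi_mul_chi (ρ : ℝ) (S : Finset (Fin n)) (x : Cube n) :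
    𝔼 y, noiseKernel ρ x y * (chi S x * chi S y) = ρ ^ #S := by
  calc 𝔼 y, noiseKernel ρ x y * (chi S x * chi S y) = chi S x * noiseOp ρ (chi S) x := by
        rw [noiseOp, mul_expect]
        exact expect_congr rfl fun y _ => by ring
    _ = ρ ^ #S := by
        rw [noiseOp_chi, mul_left_comm, chi_mul_self, mul_one]

theorem expect_noiseKernel_mul_centered (ρ : ℝ) (x : Cube n) (i j : Fin n) :
    𝔼 y, noiseKernel ρ x y * ((chi {i} x * chi {i} y - ρ) * (chi {j} x * chi {j} y - ρ)) =
      if i = j then 1 - ρ ^ 2 else 0 := by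
  have h_single (k : Fin n) : 𝔼 y, noiseKernel ρ x y * (chi {k} x * chi {k} y) = ρ := by
    rw [expect_noiseKernel_mul_chi_mul_chi, card_singleton, pow_one]
  have h_pair : 𝔼 y, noiseKernel ρ x y * ((chi {i} x * chi {i} y) * (chi {j} x * chi {j} y)) =
      if i = j then 1 else ρ ^ 2 := by
    simp only [mul_mul_mul_comm _ (chi {i} _)]
    split_ifs with hij
    · simp only [hij, chi_mul_self, mul_one, expect_noiseKernel]
    · have h_notMem : i ∉ ({j} : Finset (Fin n)) := by simpa using hij
      simp only [← chi_insert h_notMem, expect_noiseKernel_mul_chi_mul_chi, card_pair hij]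
  calc 𝔼 y, noiseKernel ρ x y * ((chi {i} x * chi {i} y - ρ) * (chi {j} x * chi {j} y - ρ))
      = (𝔼 y, noiseKernel ρ x y * ((chi {i} x * chi {i} y) * (chi {j} x * chi {j} y))) -
          ρ * (𝔼 y, noiseKernel ρ x y * (chi {i} x * chi {i} y)) -
          ρ * (𝔼 y, noiseKernel ρ x y * (chi {j} x * chi {j} y)) +
          ρ ^ 2 * 𝔼 y, noiseKernel ρ x y := by
        simp only [mul_expect, ← expect_sub_distrib, ← expect_add_distrib]
        exact expect_congr rfl fun y _ => by ring
    _ = if i = j then 1 - ρ ^ 2 else 0 := by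
        rw [h_pair, h_single, h_single, expect_noiseKernel]
        split_ifs <;> ring

theorem sum_expect_mul_sq_le_of_orthogonal {α ι : Type*} [Fintype α] [Fintype ι] [DecidableEq ι]
    {w : α → ℝ} {v : ι → α → ℝ} {c : ℝ} (hw : ∀ x, 0 ≤ w x) (hc : 0 < c)
    (hv : ∀ i j, 𝔼 x, w x * (v i x * v j x) = if i = j then c else 0) (g : α → ℝ) :
    ∑ i, (𝔼 x, w x * (g x * v i x)) ^ 2 ≤ c * 𝔼 x, w x * g x ^ 2 := by
  set a : ι → ℝ := fun i => 𝔼 x, w x * (g x * v i x) with ha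
  have h_inner : 𝔼 x, w x * (g x * ∑ i, a i * v i x) = ∑ i, a i ^ 2 := by
    simp only [mul_sum, expect_sum_comm, sq]
    refine sum_congr rfl fun i _ => ?_
    conv_rhs => rw [ha, mul_expect]
    exact expect_congr rfl fun x _ => by ring
  have h_norm : 𝔼 x, w x * (∑ i, a i * v i x) ^ 2 = c * ∑ i, a i ^ 2 := by
    calc 𝔼 x, w x * (∑ i, a i * v i x) ^ 2
        = ∑ i, ∑ j, a i * a j * 𝔼 x, w x * (v i x * v j x) := by
          simp only [sq, sum_mul_sum]
          simp only [mul_sum, mul_expect, expect_sum_comm]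
          exact sum_congr rfl fun i _ => sum_congr rfl fun j _ => expect_congr rfl fun x _ => by
            ring
      _ = c * ∑ i, a i ^ 2 := by
          simp only [hv, mul_ite, mul_zero, sum_ite_eq, mem_univ, if_true, mul_sum]
          exact sum_congr rfl fun i _ => by ring
  have h_dist : 0 ≤ 𝔼 x, w x * (c * g x - ∑ i, a i * v i x) ^ 2 :=
    expect_nonneg fun x _ => mul_nonneg (hw x) (sq_nonneg _)
  have h_expand : 𝔼 x, w x * (c * g x - ∑ i, a i * v i x) ^ 2 =
      c * (c * 𝔼 x, w x * g x ^ 2 - ∑ i, a i ^ 2) := by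
    calc 𝔼 x, w x * (c * g x - ∑ i, a i * v i x) ^ 2
        = c ^ 2 * (𝔼 x, w x * g x ^ 2) - 2 * c * (𝔼 x, w x * (g x * ∑ i, a i * v i x)) +
            𝔼 x, w x * (∑ i, a i * v i x) ^ 2 := by
          simp only [mul_expect, ← expect_sub_distrib, ← expect_add_distrib]
          exact expect_congr rfl fun x _ => by ring
      _ = c * (c * 𝔼 x, w x * g x ^ 2 - ∑ i, a i ^ 2) := by
          rw [h_inner, h_norm]
          ring
  exact sub_nonneg.1 (nonneg_of_mul_nonneg_right (h_expand ▸ h_dist) hc)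

theorem sum_noiseOp_cubeLap_sq_le {ρ : ℝ} (hρ : |ρ| ≤ 1) (g : Cube n → ℝ) (x : Cube n) :
    (1 - ρ ^ 2) * ∑ i, noiseOp ρ (cubeLap i g) x ^ 2 ≤ ρ ^ 2 * noiseOp ρ (fun y => g y ^ 2) x := by
  have h_sub : 0 ≤ 1 - ρ ^ 2 := by linarith [(sq_le_one_iff_abs_le_one ρ).2 hρ]
  have h_mean : 0 ≤ noiseOp ρ (fun y => g y ^ 2) x :=
    expect_nonneg fun y _ => mul_nonneg (noiseKernel_nonneg hρ x y) (sq_nonneg _)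
  rcases h_sub.eq_or_lt with h_zero | h_pos
  · rw [← h_zero, zero_mul]
    positivity
  · refine le_of_mul_le_mul_left ?_ h_pos
    calc (1 - ρ ^ 2) * ((1 - ρ ^ 2) * ∑ i, noiseOp ρ (cubeLap i g) x ^ 2)
        = ∑ i, ((1 - ρ ^ 2) * noiseOp ρ (cubeLap i g) x) ^ 2 := by
          simp only [mul_pow, ← mul_sum]
          ring
      _ = ρ ^ 2 * ∑ i, (𝔼 y, noiseKernel ρ x y * (g y * (chi {i} x * chi {i} y - ρ))) ^ 2 := by
          simp only [noiseOp_cubeLap, mul_pow, ← mul_sum]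
      _ ≤ ρ ^ 2 * ((1 - ρ ^ 2) * noiseOp ρ (fun y => g y ^ 2) x) :=
          mul_le_mul_of_nonneg_left (sum_expect_mul_sq_le_of_orthogonal (noiseKernel_nonneg hρ x)
            h_pos (expect_noiseKernel_mul_centered ρ x) g) (sq_nonneg ρ)
      _ = (1 - ρ ^ 2) * (ρ ^ 2 * noiseOp ρ (fun y => g y ^ 2) x) := by ring

/-! ### Charging the sensitive edges -/

theorem boolToReal_sq (f : Cube n → Bool) (x : Cube n) : boolToReal f x ^ 2 = boolToReal f x := by
  unfold boolToReal
  split_ifs <;> norm_num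

theorem boolToReal_le_one (f : Cube n → Bool) (x : Cube n) : boolToReal f x ≤ 1 := by
  unfold boolToReal
  split_ifs <;> norm_num

open Classical in
/-- The directions of the sensitive edges charged to `x`. A sensitive edge is charged to its
endpoint of value `1` if it is red and to its endpoint of value `0` if it is blue; thus exactly one
of its endpoints pays for it, and the two sensitivities count the charges. -/
noncomputable def chargedDirs (col : EdgeColoring n) (f : Cube n → Bool) (x : Cube n) :
    Finset (Fin n) :=
  {i | f (flipAt x i) ≠ f x ∧ col (edgeAt x i) = if f x then EdgeColor.red else EdgeColor.blue}

theorem mem_chargedDirs {col : EdgeColoring n} {f : Cube n → Bool} {x : Cube n} {i : Fin n} :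
    i ∈ chargedDirs col f x ↔
      f (flipAt x i) ≠ f x ∧
        col (edgeAt x i) = if f x then EdgeColor.red else EdgeColor.blue := by
  simp only [chargedDirs, mem_filter_univ]

theorem talagrandCol_eq_expect_sqrt_card (col : EdgeColoring n) (f : Cube n → Bool) :
    talagrandCol col f = 𝔼 x, √(#(chargedDirs col f x) : ℝ) := by
  rw [talagrandCol, ← expect_add_distrib]
  refine expect_congr rfl fun x _ => ?_
  have h_count (S : Finset (Fin n)) (hS : ∀ i, i ∈ S ↔ i ∈ chargedDirs col f x) :
      √(#S : ℝ) = √(#(chargedDirs col f x) : ℝ) := by rw [Finset.ext hS]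
  cases hf : f x
  · simpa [redSens, blueSens, hf] using h_count _ fun i => by simp [mem_chargedDirs, hf]
  · simpa [redSens, blueSens, hf] using h_count _ fun i => by simp [mem_chargedDirs, hf]

theorem talagrandCol_nonneg (col : EdgeColoring n) (f : Cube n → Bool) :
    0 ≤ talagrandCol col f := by
  rw [talagrandCol_eq_expect_sqrt_card]
  exact expect_nonneg fun x _ => Real.sqrt_nonneg _

theorem indicator_chargedDirs_add_flipAt_mul_cubeLap (col : EdgeColoring n) (f : Cube n → Bool)
    (i : Fin n) (x : Cube n) :
    ((if i ∈ chargedDirs col f x then 1 else 0) +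
        (if i ∈ chargedDirs col f (flipAt x i) then 1 else 0)) * cubeLap i (boolToReal f) x =
      cubeLap i (boolToReal f) x := by
  classical
  simp only [mem_chargedDirs, edgeAt_flipAt, flipAt_flipAt, cubeLap, boolToReal]
  cases f x <;> cases f (flipAt x i) <;> cases col (edgeAt x i) <;> simp

theorem two_mul_cubeLap_sq_of_mem_chargedDirs {col : EdgeColoring n} {f : Cube n → Bool}
    {x : Cube n} {i : Fin n} (hi : i ∈ chargedDirs col f x) :
    (2 * cubeLap i (boolToReal f) x) ^ 2 = 1 := by
  have h_ne : f (flipAt x i) ≠ f x := (mem_chargedDirs.1 hi).1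
  rw [cubeLap, boolToReal, boolToReal, mul_div_cancel₀ _ two_ne_zero]
  cases hf : f x <;> cases hg : f (flipAt x i) <;> simp_all

theorem expect_cubeLap_mul_eq_expect_charged (col : EdgeColoring n) (f : Cube n → Bool) (i : Fin n)
    {h : Cube n → ℝ} (h_odd : ∀ x, h (flipAt x i) = -h x) :
    𝔼 x, cubeLap i (boolToReal f) x * h x =
      𝔼 x, (if i ∈ chargedDirs col f x then 2 * cubeLap i (boolToReal f) x else 0) * h x := by
  set charge : Cube n → ℝ := fun x => if i ∈ chargedDirs col f x then 1 else 0
  have h_flip := expect_flipAt (fun x => charge x * (cubeLap i (boolToReal f) x * h x)) i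
  calc 𝔼 x, cubeLap i (boolToReal f) x * h x
      = 𝔼 x, charge x * (cubeLap i (boolToReal f) x * h x) +
          𝔼 x, charge (flipAt x i) *
            (cubeLap i (boolToReal f) (flipAt x i) * h (flipAt x i)) := by
        rw [← expect_add_distrib]
        refine expect_congr rfl fun x _ => ?_
        rw [cubeLap_flipAt, h_odd]
        linear_combination -h x * indicator_chargedDirs_add_flipAt_mul_cubeLap col f i x
    _ = 𝔼 x, (if i ∈ chargedDirs col f x then 2 * cubeLap i (boolToReal f) x else 0) * h x := by
        rw [h_flip, ← expect_add_distrib]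
        refine expect_congr rfl fun x _ => ?_
        simp only [charge]
        split_ifs <;> ring

theorem sum_expect_cubeLap_mul_le (col : EdgeColoring n) (f : Cube n → Bool)
    {h : Fin n → Cube n → ℝ} (h_odd : ∀ i x, h i (flipAt x i) = -h i x) {B : ℝ} (hB : 0 ≤ B)
    (h_sq : ∀ x, ∑ i, h i x ^ 2 ≤ B ^ 2) :
    ∑ i, 𝔼 x, cubeLap i (boolToReal f) x * h i x ≤ B * talagrandCol col f := by
  set u : Cube n → Fin n → ℝ :=
    fun x i => if i ∈ chargedDirs col f x then 2 * cubeLap i (boolToReal f) x else 0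
  have h_card (x : Cube n) : ∑ i, u x i ^ 2 = #(chargedDirs col f x) := by
    calc ∑ i, u x i ^ 2 = ∑ i, if i ∈ chargedDirs col f x then 1 else 0 := by
          refine sum_congr rfl fun i _ => ?_
          simp only [u]
          split_ifs with hi
          · exact two_mul_cubeLap_sq_of_mem_chargedDirs hi
          · exact zero_pow two_ne_zero
      _ = #(chargedDirs col f x) := by simp
  calc ∑ i, 𝔼 x, cubeLap i (boolToReal f) x * h i x = 𝔼 x, ∑ i, u x i * h i x := by
        rw [expect_sum_comm]
        exact sum_congr rfl fun i _ => expect_cubeLap_mul_eq_expect_charged col f i (h_odd i)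
    _ ≤ 𝔼 x, √(∑ i, u x i ^ 2) * √(∑ i, h i x ^ 2) :=
        expect_le_expect fun x _ => Real.sum_mul_le_sqrt_mul_sqrt univ (u x) (h · x)
    _ ≤ 𝔼 x, √(#(chargedDirs col f x) : ℝ) * B := by
        refine expect_le_expect fun x _ => ?_
        rw [h_card]
        exact mul_le_mul_of_nonneg_left (Real.sqrt_le_iff.2 ⟨hB, h_sq x⟩) (Real.sqrt_nonneg _)
    _ = B * talagrandCol col f := by
        rw [talagrandCol_eq_expect_sqrt_card, ← expect_mul, mul_comm]

theorem sqrt_weightEq_one_le_talagrandCol (col : EdgeColoring n) (f : Cube n → Bool) :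
    √(weightEq 1 (boolToReal f)) ≤ talagrandCol col f := by
  set W := weightEq 1 (boolToReal f)
  have hW : ∑ i, cubeFourier (boolToReal f) {i} ^ 2 = √W ^ 2 := by
    rw [← weightEq_one]
    exact (Real.sq_sqrt (sum_nonneg fun _ _ => sq_nonneg _)).symm
  have h_dual : √W ^ 2 ≤ √W * talagrandCol col f := by
    refine le_of_eq_of_le ?_ (sum_expect_cubeLap_mul_le col f
      (h := fun i x => cubeFourier (boolToReal f) {i} * chi {i} x) (fun i x => ?_)
      (Real.sqrt_nonneg W) fun x => ?_)
    · rw [← hW]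
      refine sum_congr rfl fun i _ => ?_
      have h_lap := cubeFourier_cubeLap i (boolToReal f) {i}
      rw [if_pos (mem_singleton_self i), cubeFourier] at h_lap
      simp only [mul_left_comm _ (cubeFourier _ _), ← mul_expect, h_lap, sq]
    · rw [chi_singleton_flipAt, mul_neg]
    · simp only [mul_pow, chi_sq, mul_one, hW, le_refl]
  rcases (Real.sqrt_nonneg W).eq_or_lt with h_zero | h_pos
  · exact h_zero ▸ talagrandCol_nonneg col f
  · exact le_of_mul_le_mul_left (by linarith) h_pos

/-! ### Fourier tails -/

theorem sqrt_mul_sum_card_mul_pow_le (col : EdgeColoring n) (f : Cube n → Bool) {ρ : ℝ}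
    (h0 : 0 ≤ ρ) (h1 : ρ ≤ 1) :
    √(1 - ρ ^ 2) * ∑ S, #S * ρ ^ #S * cubeFourier (boolToReal f) S ^ 2 ≤
      ρ * talagrandCol col f := by
  have hρ : |ρ| ≤ 1 := by rwa [abs_of_nonneg h0]
  have h_sub : 0 ≤ 1 - ρ ^ 2 := by linarith [pow_le_one₀ h0 h1 (n := 2)]
  refine le_of_eq_of_le ?_ (sum_expect_cubeLap_mul_le col f
    (h := fun i x => √(1 - ρ ^ 2) * noiseOp ρ (cubeLap i (boolToReal f)) x) (fun i x => ?_) h0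
    fun x => ?_)
  · simp only [← sum_noiseStab_cubeLap, mul_sum, noiseStab, mul_left_comm _ √(1 - ρ ^ 2),
      ← mul_expect]
  · rw [noiseOp_cubeLap_flipAt, mul_neg]
  · calc ∑ i, (√(1 - ρ ^ 2) * noiseOp ρ (cubeLap i (boolToReal f)) x) ^ 2
        = (1 - ρ ^ 2) * ∑ i, noiseOp ρ (cubeLap i (boolToReal f)) x ^ 2 := by
          simp only [mul_pow, Real.sq_sqrt h_sub, mul_sum]
      _ ≤ ρ ^ 2 * noiseOp ρ (fun y => boolToReal f y ^ 2) x :=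
          sum_noiseOp_cubeLap_sq_le hρ _ x
      _ ≤ ρ ^ 2 * noiseOp ρ (fun _ => 1) x := by
          refine mul_le_mul_of_nonneg_left (noiseOp_mono hρ (fun y => ?_) x) (sq_nonneg ρ)
          rw [boolToReal_sq]
          exact boolToReal_le_one f y
      _ = ρ ^ 2 := by rw [noiseOp_const, mul_one]

theorem cubeVar_sub_noiseCov (ρ : ℝ) (g : Cube n → ℝ) :
    cubeVar g - noiseCov ρ g = ∑ S, (1 - ρ ^ #S) * cubeFourier g S ^ 2 := by
  rw [cubeVar_eq_sum, noiseCov_eq_sum, ← sum_sub_distrib, sum_filter]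
  refine sum_congr rfl fun S _ => ?_
  rcases S.eq_empty_or_nonempty with rfl | hS
  · simp
  · rw [if_pos hS]
    ring

theorem sum_card_mul_cos_pow_mul_sin_le (col : EdgeColoring n) (f : Cube n → Bool) {t : ℝ}
    (h0 : 0 ≤ t) (h1 : t < Real.pi / 2) :
    ∑ S, #S * Real.cos t ^ (#S - 1) * Real.sin t * cubeFourier (boolToReal f) S ^ 2 ≤
      talagrandCol col f := by
  have h_cos : 0 < Real.cos t := Real.cos_pos_of_mem_Ioo ⟨by linarith, h1⟩
  have h_sin : √(1 - Real.cos t ^ 2) = Real.sin t := by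
    rw [← Real.sin_sq, Real.sqrt_sq]
    exact Real.sin_nonneg_of_nonneg_of_le_pi h0 (by linarith)
  refine le_of_mul_le_mul_left ?_ h_cos
  refine le_of_eq_of_le ?_ (sqrt_mul_sum_card_mul_pow_le col f h_cos.le (Real.cos_le_one t))
  rw [h_sin, mul_sum, mul_sum]
  refine sum_congr rfl fun S _ => ?_
  rcases S.eq_empty_or_nonempty with rfl | hS
  · simp
  · rw [← pow_sub_one_mul hS.card_pos.ne' (Real.cos t)]
    ring

theorem cubeVar_sub_noiseCov_cos_le (col : EdgeColoring n) (f : Cube n → Bool) {θ : ℝ}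
    (h0 : 0 ≤ θ) (h1 : θ ≤ Real.pi / 2) :
    cubeVar (boolToReal f) - noiseCov (Real.cos θ) (boolToReal f) ≤ θ * talagrandCol col f := by
  set a : Finset (Fin n) → ℝ := fun S => cubeFourier (boolToReal f) S ^ 2
  set F : ℝ → ℝ := fun t => t * talagrandCol col f - ∑ S, (1 - Real.cos t ^ #S) * a S
  have h_deriv (t : ℝ) : HasDerivAt F
      (1 * talagrandCol col f - ∑ S, -(#S * Real.cos t ^ (#S - 1) * -Real.sin t) * a S) t :=
    ((hasDerivAt_id t).mul_const _).sub <| HasDerivAt.fun_sum fun S _ =>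
      (((Real.hasDerivAt_cos t).pow _).const_sub 1).mul_const _
  have h_mono : MonotoneOn F (Set.Icc 0 (Real.pi / 2)) := by
    refine monotoneOn_of_deriv_nonneg (convex_Icc _ _)
      (fun t _ => (h_deriv t).continuousAt.continuousWithinAt)
      (fun t _ => (h_deriv t).differentiableAt.differentiableWithinAt) fun t ht => ?_
    rw [interior_Icc] at ht
    simp only [(h_deriv t).deriv, one_mul, sub_nonneg, mul_neg, neg_neg]
    exact sum_card_mul_cos_pow_mul_sin_le col f ht.1.le ht.2
  have h_le := h_mono ⟨le_rfl, by positivity⟩ ⟨h0, h1⟩ h0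
  simp only [F, Real.cos_zero, one_pow, sub_self, zero_mul, sum_const_zero] at h_le
  rw [cubeVar_sub_noiseCov]
  linarith

theorem cos_one_div_sqrt_pow_le {d : ℕ} (hd : 1 ≤ d) : Real.cos (1 / √d) ^ d ≤ 3 / 4 := by
  have h_sqrt : 1 ≤ √(d : ℝ) := Real.one_le_sqrt.2 (by exact_mod_cast hd)
  have h_le_one : 1 / √(d : ℝ) ≤ 1 := by rw [div_le_one (by linarith)]; exact h_sqrt
  have h_pos : 0 < 1 / √(d : ℝ) := by positivity
  have h_cos : 0 ≤ Real.cos (1 / √d) :=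
    Real.cos_nonneg_of_neg_pi_div_two_le_of_le (by linarith [Real.pi_gt_three])
      (by linarith [Real.pi_gt_three])
  have h_tan := Real.cos_le_one_div_sqrt_sq_add_one (x := 1 / √d)
    (by linarith [Real.pi_gt_three]) (by linarith [Real.pi_gt_three])
  have h_bernoulli : 2 ≤ (1 + 1 / (d : ℝ)) ^ d := by
    have h_inv : 0 ≤ 1 / (d : ℝ) := by positivity
    have h_cancel : (d : ℝ) * (1 / d) = 1 := mul_one_div_cancel (by positivity)
    linarith [one_add_mul_le_pow (show -2 ≤ 1 / (d : ℝ) by linarith) d]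
  have h_sq : (Real.cos (1 / √d) ^ d) ^ 2 ≤ 1 / 2 := by
    calc (Real.cos (1 / √d) ^ d) ^ 2 = (Real.cos (1 / √d) ^ 2) ^ d := by ring
      _ ≤ ((1 / √((1 / √d) ^ 2 + 1)) ^ 2) ^ d := by gcongr
      _ = 1 / (1 + 1 / (d : ℝ)) ^ d := by
          rw [div_pow, Real.sq_sqrt (by positivity), div_pow 1 √(d : ℝ), Real.sq_sqrt d.cast_nonneg,
            one_pow, div_pow, one_pow, add_comm]
      _ ≤ 1 / 2 := by gcongr
  nlinarith [pow_nonneg h_cos d]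

theorem sqrt_mul_weightGe_le (col : EdgeColoring n) (f : Cube n → Bool) (d : ℕ) :
    √d * weightGe d (boolToReal f) ≤ 4 * talagrandCol col f := by
  rcases d.eq_zero_or_pos with rfl | hd
  · simpa using talagrandCol_nonneg col f
  have h_sqrt : 1 ≤ √(d : ℝ) := Real.one_le_sqrt.2 (by exact_mod_cast hd)
  have h_angle : 1 / √(d : ℝ) ≤ Real.pi / 2 := by
    have : 1 / √(d : ℝ) ≤ 1 := by rw [div_le_one (by linarith)]; exact h_sqrt
    linarith [Real.pi_gt_three]
  have h_angle_nonneg : 0 ≤ 1 / √(d : ℝ) := by positivity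
  have h_cos : 0 ≤ Real.cos (1 / √d) :=
    Real.cos_nonneg_of_neg_pi_div_two_le_of_le (by linarith [Real.pi_pos]) h_angle
  have h_tail : 1 / 4 * weightGe d (boolToReal f) ≤
      cubeVar (boolToReal f) - noiseCov (Real.cos (1 / √d)) (boolToReal f) := by
    rw [cubeVar_sub_noiseCov, weightGe, mul_sum, sum_filter]
    refine sum_le_sum fun S _ => ?_
    split_ifs with hS
    · refine mul_le_mul_of_nonneg_right ?_ (sq_nonneg _)
      linarith [cos_one_div_sqrt_pow_le hd, pow_le_pow_of_le_one h_cos (Real.cos_le_one _) hS]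
    · exact mul_nonneg (sub_nonneg.2 (pow_le_one₀ h_cos (Real.cos_le_one _))) (sq_nonneg _)
  have h_flow := h_tail.trans (cubeVar_sub_noiseCov_cos_le col f h_angle_nonneg h_angle)
  rw [one_div_mul_eq_div, one_div_mul_eq_div,
    div_le_div_iff₀ (by norm_num) (by positivity)] at h_flow
  linarith

theorem cubeVar_le (col : EdgeColoring n) (f : Cube n → Bool) :
    cubeVar (boolToReal f) ≤ 4 * talagrandCol col f := by
  simpa [weightGe_one] using sqrt_mul_weightGe_le col f 1

/-! ### Hypercontractivity -/

theorem expect_add_chi_singleton_mul_pow_four {i : Fin n} {g h : Cube n → ℝ}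
    (hg : ∀ x, g (flipAt x i) = g x) (hh : ∀ x, h (flipAt x i) = h x) :
    𝔼 x, (g x + chi {i} x * h x) ^ 4 =
      𝔼 x, g x ^ 4 + 6 * 𝔼 x, g x ^ 2 * h x ^ 2 + 𝔼 x, h x ^ 4 := by
  have h_odd : 𝔼 x, chi {i} x * (4 * g x ^ 3 * h x + 4 * g x * h x ^ 3) = 0 := by
    refine expect_eq_zero_of_flipAt_eq_neg (i := i) fun x => ?_
    rw [hg, hh, chi_singleton_flipAt, neg_mul]
  rw [mul_expect, ← add_zero (_ + _), ← h_odd]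
  simp only [← expect_add_distrib]
  refine expect_congr rfl fun x _ => ?_
  linear_combination (6 * g x ^ 2 * h x ^ 2 + 4 * chi {i} x * g x * h x ^ 3 +
    (chi {i} x ^ 2 + 1) * h x ^ 4) * chi_sq {i} x

theorem expect_sq_mul_sq_le {α : Type*} [Fintype α] {g h : α → ℝ} {A B : ℝ} (hA : 0 ≤ A)
    (hB : 0 ≤ B) (hg : 𝔼 x, g x ^ 4 ≤ A ^ 2) (hh : 𝔼 x, h x ^ 4 ≤ B ^ 2) :
    𝔼 x, g x ^ 2 * h x ^ 2 ≤ A * B := by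
  refine (abs_le_of_sq_le_sq' ?_ (mul_nonneg hA hB)).2
  calc (𝔼 x, g x ^ 2 * h x ^ 2) ^ 2 ≤ (𝔼 x, (g x ^ 2) ^ 2) * 𝔼 x, (h x ^ 2) ^ 2 :=
        expect_mul_sq_le_sq_mul_sq univ _ _
    _ = (𝔼 x, g x ^ 4) * 𝔼 x, h x ^ 4 := by simp only [← pow_mul, Nat.reduceMul]
    _ ≤ A ^ 2 * B ^ 2 := mul_le_mul hg hh (expect_nonneg fun x _ => by positivity) (sq_nonneg _)
    _ = (A * B) ^ 2 := (mul_pow _ _ 2).symm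

theorem expect_sum_powerset_mul_chi_pow_four_le (U : Finset (Fin n)) (a : Finset (Fin n) → ℝ) :
    𝔼 x, (∑ S ∈ U.powerset, a S * chi S x) ^ 4 ≤ (∑ S ∈ U.powerset, 3 ^ #S * a S ^ 2) ^ 2 := by
  induction U using Finset.induction_on generalizing a with
  | empty => simp [chi_empty, ← pow_mul]
  | insert i U hi ih =>
    have h_notMem {S : Finset (Fin n)} (hS : S ∈ U.powerset) : i ∉ S :=
      fun h => hi (mem_powerset.1 hS h)
    set b : Finset (Fin n) → ℝ := fun S => a (insert i S)
    set part : (Finset (Fin n) → ℝ) → Cube n → ℝ := fun c x => ∑ S ∈ U.powerset, c S * chi S x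
    set wt : (Finset (Fin n) → ℝ) → ℝ := fun c => ∑ S ∈ U.powerset, 3 ^ #S * c S ^ 2
    have h_wt_nonneg (c) : 0 ≤ wt c := by positivity
    have h_part_flip (c) (x) : part c (flipAt x i) = part c x :=
      sum_congr rfl fun S hS => by rw [chi_flipAt_of_notMem (h_notMem hS)]
    have h_split (x) : ∑ S ∈ (insert i U).powerset, a S * chi S x =
        part a x + chi {i} x * part b x := by
      rw [sum_powerset_insert hi, mul_sum]
      congr 1
      exact sum_congr rfl fun S hS => by rw [chi_insert (h_notMem hS)]; ring
    have h_wt_split : ∑ S ∈ (insert i U).powerset, 3 ^ #S * a S ^ 2 = wt a + 3 * wt b := by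
      rw [sum_powerset_insert hi, mul_sum]
      congr 1
      exact sum_congr rfl fun S hS => by rw [card_insert_of_notMem (h_notMem hS)]; ring
    have h_cross : 𝔼 x, part a x ^ 2 * part b x ^ 2 ≤ wt a * wt b :=
      expect_sq_mul_sq_le (h_wt_nonneg a) (h_wt_nonneg b) (ih a) (ih b)
    simp only [h_split, h_wt_split,
      expect_add_chi_singleton_mul_pow_four (h_part_flip a) (h_part_flip b)]
    nlinarith [ih a, ih b, sq_nonneg (wt b)]

theorem expect_noiseOp_one_third_pow_four_le (g : Cube n → ℝ) :
    𝔼 x, noiseOp (1 / 3) g x ^ 4 ≤ noiseStab (1 / 3) g ^ 2 := by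
  have h_bonami := expect_sum_powerset_mul_chi_pow_four_le univ
    fun S => (1 / 3) ^ #S * cubeFourier g S
  simp only [powerset_univ, ← noiseOp_eq_sum] at h_bonami
  refine h_bonami.trans_eq ?_
  rw [noiseStab_eq_sum]
  congr 1
  refine sum_congr rfl fun S _ => ?_
  rw [mul_pow, ← pow_mul, mul_comm #S, pow_mul, ← mul_assoc, ← mul_pow]
  norm_num

theorem sq_expect_mul_le {α : Type*} [Fintype α] (g h : α → ℝ) :
    (𝔼 x, g x * h x) ^ 2 ≤ (𝔼 x, |g x|) * (√(𝔼 x, g x ^ 2) * √(𝔼 x, h x ^ 4)) := by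
  have h_abs : |𝔼 x, g x * h x| ≤ 𝔼 x, √|g x| * (√|g x| * |h x|) := by
    refine (abs_expect_le _ _).trans_eq (expect_congr rfl fun x _ => ?_)
    rw [← mul_assoc, Real.mul_self_sqrt (abs_nonneg _), abs_mul]
  have h_weighted : 𝔼 x, |g x| * h x ^ 2 ≤ √(𝔼 x, g x ^ 2) * √(𝔼 x, h x ^ 4) := by
    rw [← Real.sqrt_mul (expect_nonneg fun x _ => sq_nonneg _)]
    refine Real.le_sqrt_of_sq_le ?_
    refine (expect_mul_sq_le_sq_mul_sq univ (fun x => |g x|) fun x => h x ^ 2).trans_eq ?_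
    simp only [sq_abs, ← pow_mul, Nat.reduceMul]
  calc (𝔼 x, g x * h x) ^ 2 = |𝔼 x, g x * h x| ^ 2 := (sq_abs _).symm
    _ ≤ (𝔼 x, √|g x| * (√|g x| * |h x|)) ^ 2 := by gcongr
    _ ≤ (𝔼 x, √|g x| ^ 2) * 𝔼 x, (√|g x| * |h x|) ^ 2 := expect_mul_sq_le_sq_mul_sq univ _ _
    _ = (𝔼 x, |g x|) * 𝔼 x, |g x| * h x ^ 2 := by
        simp only [mul_pow, Real.sq_sqrt (abs_nonneg _), sq_abs]
    _ ≤ (𝔼 x, |g x|) * (√(𝔼 x, g x ^ 2) * √(𝔼 x, h x ^ 4)) :=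
        mul_le_mul_of_nonneg_left h_weighted (expect_nonneg fun x _ => abs_nonneg _)

theorem noiseStab_one_third_le (g : Cube n → ℝ) :
    noiseStab (1 / 3) g ≤ (𝔼 x, |g x|) * √(𝔼 x, g x ^ 2) := by
  have h_nonneg : 0 ≤ noiseStab (1 / 3) g := noiseStab_nonneg (by norm_num) g
  have h_sq : noiseStab (1 / 3) g ^ 2 ≤
      (𝔼 x, |g x|) * √(𝔼 x, g x ^ 2) * noiseStab (1 / 3) g := by
    calc noiseStab (1 / 3) g ^ 2
        ≤ (𝔼 x, |g x|) * (√(𝔼 x, g x ^ 2) * √(𝔼 x, noiseOp (1 / 3) g x ^ 4)) :=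
          sq_expect_mul_le g _
      _ ≤ (𝔼 x, |g x|) * (√(𝔼 x, g x ^ 2) * noiseStab (1 / 3) g) := by
          gcongr
          exact Real.sqrt_le_iff.2 ⟨h_nonneg, expect_noiseOp_one_third_pow_four_le g⟩
      _ = (𝔼 x, |g x|) * √(𝔼 x, g x ^ 2) * noiseStab (1 / 3) g := by ring
  rcases h_nonneg.eq_or_lt with h_zero | h_pos
  · rw [← h_zero]
    positivity
  · exact le_of_mul_le_mul_right (by linarith) h_pos

/-! ### Logarithmic bounds from small noise covariance -/

theorem pow_mul_cubeVar_le {ρ : ℝ} (h0 : 0 ≤ ρ) (h1 : ρ ≤ 1) (d : ℕ) (g : Cube n → ℝ) :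
    ρ ^ d * cubeVar g ≤ noiseCov ρ g + ρ ^ d * weightGe (d + 1) g := by
  rw [cubeVar_eq_sum, noiseCov_eq_sum, weightGe, mul_sum, mul_sum]
  simp only [sum_filter, ← sum_add_distrib]
  refine sum_le_sum fun S _ => ?_
  by_cases hS : S.Nonempty
  · rw [if_pos hS, if_pos hS]
    split_ifs with hd
    · exact le_add_of_nonneg_left (by positivity)
    · rw [add_zero]
      exact mul_le_mul_of_nonneg_right (pow_le_pow_of_le_one h0 h1 (by omega)) (sq_nonneg _)
  · rw [if_neg hS, if_neg hS]
    positivity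

theorem cubeVar_sq_mul_add_one_le_of_noiseCov_le (col : EdgeColoring n) (f : Cube n → Bool)
    {ρ : ℝ} (h0 : 0 < ρ) (h1 : ρ ≤ 1) {d : ℕ}
    (h_cov : noiseCov ρ (boolToReal f) ≤ ρ ^ d * (cubeVar (boolToReal f) / 2)) :
    cubeVar (boolToReal f) ^ 2 * (d + 1) ≤ 64 * talagrandCol col f ^ 2 := by
  set V := cubeVar (boolToReal f)
  have hV : 0 ≤ V := cubeVar_nonneg _
  have h_tail : V ≤ 2 * weightGe (d + 1) (boolToReal f) := by
    refine le_of_mul_le_mul_left ?_ (pow_pos h0 d)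
    linarith [pow_mul_cubeVar_le h0.le h1 d (boolToReal f)]
  have h_bound : √(d + 1 : ℝ) * V ≤ 8 * talagrandCol col f := by
    have h_weight := sqrt_mul_weightGe_le col f (d + 1)
    push_cast at h_weight
    nlinarith [Real.sqrt_nonneg (d + 1 : ℝ)]
  calc V ^ 2 * (d + 1) = (√(d + 1 : ℝ) * V) ^ 2 := by
        rw [mul_pow, Real.sq_sqrt (by positivity), mul_comm]
    _ ≤ (8 * talagrandCol col f) ^ 2 := by gcongr
    _ = 64 * talagrandCol col f ^ 2 := by ring

theorem exists_cubeVar_sq_mul_add_one_le (col : EdgeColoring n) (f : Cube n → Bool) {ρ Q : ℝ}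
    (h0 : 0 < ρ) (h1 : ρ < 1) (hQ : 0 < Q) (h_cov : noiseCov ρ (boolToReal f) ≤ Q) :
    ∃ d : ℕ, cubeVar (boolToReal f) ^ 2 * (d + 1) ≤ 64 * talagrandCol col f ^ 2 ∧
      cubeVar (boolToReal f) / Q ≤ 2 * ρ⁻¹ ^ (d + 1) := by
  set V := cubeVar (boolToReal f)
  have h_inv : 1 < ρ⁻¹ := (one_lt_inv₀ h0).2 h1
  rcases lt_or_ge V (2 * Q) with h_small | h_large
  · refine ⟨0, ?_, ?_⟩
    · have h_var := pow_le_pow_left₀ (cubeVar_nonneg _) (cubeVar_le col f) 2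
      rw [Nat.cast_zero, zero_add, mul_one]
      linarith [sq_nonneg (talagrandCol col f)]
    · rw [zero_add, pow_one]
      linarith [(div_le_iff₀ hQ).2 h_small.le]
  · have h_ratio : 1 ≤ V / (2 * Q) := (one_le_div (by positivity)).2 h_large
    obtain ⟨d, hd_le, hd_lt⟩ := exists_nat_pow_near h_ratio h_inv
    have h_half : Q ≤ ρ ^ d * (V / 2) := by
      rw [inv_pow, inv_le_comm₀ (by positivity) (by positivity), inv_div,
        div_le_iff₀ (by linarith)] at hd_le
      linarith
    refine ⟨d, cubeVar_sq_mul_add_one_le_of_noiseCov_le col f h0 h1.le (h_cov.trans h_half), ?_⟩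
    rw [div_lt_iff₀ (by positivity)] at hd_lt
    rw [div_le_iff₀ hQ]
    linarith

theorem cubeVar_sq_mul_log_le (col : EdgeColoring n) (f : Cube n → Bool) {ρ Q : ℝ} (h0 : 0 < ρ)
    (h1 : ρ < 1) (hQ : 0 < Q) (h_cov : noiseCov ρ (boolToReal f) ≤ Q) :
    cubeVar (boolToReal f) ^ 2 * Real.log (cubeVar (boolToReal f) / Q) ≤
      64 * Real.log (2 / ρ) * talagrandCol col f ^ 2 := by
  obtain ⟨d, h_weight, h_ratio⟩ := exists_cubeVar_sq_mul_add_one_le col f h0 h1 hQ h_cov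
  set V := cubeVar (boolToReal f)
  set T := talagrandCol col f
  have h_log_nonneg : 0 ≤ Real.log (2 / ρ) := Real.log_nonneg ((one_le_div h0).2 (by linarith))
  rcases (cubeVar_nonneg (boolToReal f)).eq_or_lt with h_zero | hV
  · rw [show V = 0 from h_zero.symm, zero_pow two_ne_zero, zero_mul]
    positivity
  have h_log_ratio : Real.log (V / Q) ≤ (d + 1) * Real.log (2 / ρ) := by
    have h_log := Real.log_le_log (by positivity) h_ratio
    rw [Real.log_mul two_ne_zero (by positivity), Real.log_pow, Nat.cast_add_one] at h_log
    rw [div_eq_mul_inv 2 ρ, Real.log_mul two_ne_zero (inv_ne_zero h0.ne')]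
    nlinarith [Real.log_nonneg one_le_two, Nat.cast_nonneg (α := ℝ) d]
  calc V ^ 2 * Real.log (V / Q) ≤ V ^ 2 * ((d + 1) * Real.log (2 / ρ)) := by gcongr
    _ = V ^ 2 * (d + 1) * Real.log (2 / ρ) := by ring
    _ ≤ 64 * T ^ 2 * Real.log (2 / ρ) := by gcongr
    _ = 64 * Real.log (2 / ρ) * T ^ 2 := by ring

theorem cubeVar_boolToReal (f : Cube n → Bool) :
    cubeVar (boolToReal f) = (𝔼 x, boolToReal f x) * (1 - 𝔼 x, boolToReal f x) := by
  set μ := 𝔼 x, boolToReal f x with hμ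
  calc cubeVar (boolToReal f) = 𝔼 x, ((1 - 2 * μ) * boolToReal f x + μ ^ 2) :=
        expect_congr rfl fun x _ => by linear_combination boolToReal_sq f x
    _ = μ * (1 - μ) := by
        rw [expect_add_distrib, ← mul_expect, Fintype.expect_const, ← hμ]
        ring

theorem expect_abs_boolToReal_sub_expect (f : Cube n → Bool) :
    𝔼 x, |boolToReal f x - 𝔼 y, boolToReal f y| = 2 * cubeVar (boolToReal f) := by
  set μ := 𝔼 x, boolToReal f x with hμ
  have h_nonneg : 0 ≤ μ := expect_nonneg fun x _ => by rw [← boolToReal_sq]; positivity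
  have h_le_one : μ ≤ 1 := expect_le univ_nonempty fun x _ => boolToReal_le_one f x
  calc 𝔼 x, |boolToReal f x - μ| = 𝔼 x, ((1 - 2 * μ) * boolToReal f x + μ) := by
        refine expect_congr rfl fun x _ => ?_
        unfold boolToReal
        split_ifs
        · rw [abs_of_nonneg (by linarith)]; ring
        · rw [abs_of_nonpos (by linarith)]; ring
    _ = 2 * cubeVar (boolToReal f) := by
        rw [cubeVar_boolToReal, expect_add_distrib, ← mul_expect, Fintype.expect_const, ← hμ]
        ring

theorem noiseCov_one_third_le (f : Cube n → Bool) :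
    noiseCov (1 / 3) (boolToReal f) ≤
      2 * cubeVar (boolToReal f) * √(cubeVar (boolToReal f)) := by
  rw [← expect_abs_boolToReal_sub_expect]
  exact noiseStab_one_third_le _

theorem mul_sqrt_le_of_sq_mul_le {a b L : ℝ} (ha : 0 ≤ a) (hb : 0 ≤ b) (h : a ^ 2 * L ≤ b ^ 2) :
    a * √L ≤ b := by
  rw [← Real.sqrt_sq ha, ← Real.sqrt_mul (sq_nonneg a)]
  exact Real.sqrt_le_iff.2 ⟨hb, h⟩

theorem cubeVar_sq_mul_log_one_div_le (col : EdgeColoring n) (f : Cube n → Bool) :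
    cubeVar (boolToReal f) ^ 2 * Real.log (1 / cubeVar (boolToReal f)) ≤
      416 * Real.log 2 * talagrandCol col f ^ 2 := by
  set V := cubeVar (boolToReal f)
  set T := talagrandCol col f
  have h_log2 : 0 ≤ Real.log 2 := Real.log_nonneg one_le_two
  rcases (cubeVar_nonneg (boolToReal f)).eq_or_lt with h_zero | hV
  · rw [show V = 0 from h_zero.symm, zero_pow two_ne_zero, zero_mul]
    positivity
  have h_core : V ^ 2 * Real.log (V / (2 * V * √V)) ≤ 64 * Real.log (2 / (1 / 3)) * T ^ 2 :=
    cubeVar_sq_mul_log_le col f (by norm_num) (by norm_num) (by positivity)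
      (noiseCov_one_third_le f)
  have h_log : Real.log (1 / V) = 2 * Real.log 2 + 2 * Real.log (V / (2 * V * √V)) := by
    rw [Real.log_div one_ne_zero hV.ne', Real.log_div hV.ne' (by positivity),
      Real.log_mul (by positivity) (by positivity), Real.log_mul two_ne_zero hV.ne',
      Real.log_sqrt hV.le, Real.log_one]
    ring
  have h_log6 : Real.log (2 / (1 / 3)) ≤ 3 * Real.log 2 := by
    rw [show 3 * Real.log 2 = Real.log (2 ^ 3) by rw [Real.log_pow]; norm_num]
    exact Real.log_le_log (by norm_num) (by norm_num)
  have h_var : V ^ 2 ≤ (4 * T) ^ 2 := pow_le_pow_left₀ hV.le (cubeVar_le col f) 2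
  rw [h_log]
  nlinarith [mul_le_mul_of_nonneg_right h_log6 (sq_nonneg T)]

theorem cubeVar_mul_sqrt_log_one_div_le (col : EdgeColoring n) (f : Cube n → Bool) :
    cubeVar (boolToReal f) * √(Real.log (1 / cubeVar (boolToReal f))) ≤
      18 * talagrandCol col f := by
  refine mul_sqrt_le_of_sq_mul_le (cubeVar_nonneg _)
    (mul_nonneg (by norm_num) (talagrandCol_nonneg col f)) ?_
  nlinarith [cubeVar_sq_mul_log_one_div_le col f, Real.log_two_lt_d9,
    sq_nonneg (talagrandCol col f)]

/-! ### Small influences -/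

theorem sum_noiseStab_one_fourth_cubeLap_le (g : Cube n → ℝ) :
    ∑ i, noiseStab (1 / 4) (cubeLap i g) ≤ 𝔼 x, g x ^ 2 := by
  rw [sum_noiseStab_cubeLap, expect_sq_eq_sum_cubeFourier_sq]
  refine sum_le_sum fun S _ => mul_le_of_le_one_left (sq_nonneg _) ?_
  rw [one_div_pow, mul_one_div, div_le_one (by positivity)]
  exact_mod_cast (Nat.lt_pow_self (by norm_num)).le

theorem noiseCov_one_twelfth_le (g : Cube n → ℝ) :
    noiseCov (1 / 12) g ≤ √(∑ i, (𝔼 x, |cubeLap i g x|) ^ 2) * √(𝔼 x, g x ^ 2) := by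
  calc noiseCov (1 / 12) g ≤ ∑ i, noiseStab (1 / 12) (cubeLap i g) :=
        noiseCov_le_sum_noiseStab_cubeLap (by norm_num) g
    _ = ∑ i, noiseStab (1 / 3) (noiseOp (1 / 2) (cubeLap i g)) := by
        refine sum_congr rfl fun i _ => ?_
        rw [noiseStab_noiseOp]
        norm_num
    _ ≤ ∑ i, (𝔼 x, |cubeLap i g x|) * √(noiseStab (1 / 4) (cubeLap i g)) := by
        refine sum_le_sum fun i _ => (noiseStab_one_third_le _).trans ?_
        rw [expect_noiseOp_sq, show (1 / 2 : ℝ) ^ 2 = 1 / 4 by norm_num]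
        exact mul_le_mul_of_nonneg_right (expect_abs_noiseOp_le (by norm_num [abs_le]) _)
          (Real.sqrt_nonneg _)
    _ ≤ √(∑ i, (𝔼 x, |cubeLap i g x|) ^ 2) *
          √(∑ i, √(noiseStab (1 / 4) (cubeLap i g)) ^ 2) :=
        Real.sum_mul_le_sqrt_mul_sqrt _ _ _
    _ ≤ √(∑ i, (𝔼 x, |cubeLap i g x|) ^ 2) * √(𝔼 x, g x ^ 2) := by
        simp only [Real.sq_sqrt (noiseStab_nonneg (ρ := 1 / 4) (by norm_num) _)]
        gcongr
        exact sum_noiseStab_one_fourth_cubeLap_le g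

theorem expect_abs_cubeLap_boolToReal (f : Cube n → Bool) (i : Fin n) :
    𝔼 x, |cubeLap i (boolToReal f) x| = influence f i / 2 := by
  rw [influence, expect_div]
  refine expect_congr rfl fun x _ => ?_
  rw [cubeLap, boolToReal, boolToReal]
  cases f x <;> cases f (flipAt x i) <;> norm_num

theorem noiseCov_one_twelfth_le_sqrt_sum_influence_sq (f : Cube n → Bool) :
    noiseCov (1 / 12) (boolToReal f) ≤ √(∑ i, influence f i ^ 2) := by
  have h_sq : 𝔼 x, boolToReal f x ^ 2 ≤ 1 :=
    expect_le univ_nonempty fun x _ => by rw [boolToReal_sq]; exact boolToReal_le_one f x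
  calc noiseCov (1 / 12) (boolToReal f)
      ≤ √(∑ i, (influence f i / 2) ^ 2) * √(𝔼 x, boolToReal f x ^ 2) := by
        simpa only [expect_abs_cubeLap_boolToReal] using noiseCov_one_twelfth_le (boolToReal f)
    _ ≤ √(∑ i, influence f i ^ 2) * 1 := by
        refine mul_le_mul (Real.sqrt_le_sqrt (sum_le_sum fun i _ => ?_)) (Real.sqrt_le_one.2 h_sq)
          (Real.sqrt_nonneg _) (Real.sqrt_nonneg _)
        nlinarith [sq_nonneg (influence f i)]
    _ = √(∑ i, influence f i ^ 2) := mul_one _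

theorem log_one_add_one_div_le {V M : ℝ} (hV : 0 < V) (hM : 0 < M) (h_le_one : M ≤ 1) :
    Real.log (1 + 1 / M) ≤ Real.log 2 + 2 * Real.log (V / √M) + 2 * Real.log (1 / V) := by
  calc Real.log (1 + 1 / M) ≤ Real.log (2 * (1 / M)) :=
        Real.log_le_log (by positivity) (by linarith [(one_le_div hM).2 h_le_one])
    _ = Real.log 2 + 2 * Real.log (V / √M) + 2 * Real.log (1 / V) := by
        rw [Real.log_mul two_ne_zero (by positivity), Real.log_div one_ne_zero hM.ne',
          Real.log_div hV.ne' (by positivity), Real.log_sqrt hM.le,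
          Real.log_div one_ne_zero hV.ne', Real.log_one]
        ring

theorem cubeVar_sq_mul_log_one_add_one_div_le (col : EdgeColoring n) (f : Cube n → Bool) :
    cubeVar (boolToReal f) ^ 2 * Real.log (1 + 1 / ∑ i, influence f i ^ 2) ≤
      1488 * Real.log 2 * talagrandCol col f ^ 2 := by
  set V := cubeVar (boolToReal f)
  set T := talagrandCol col f
  set M := ∑ i, influence f i ^ 2
  have h_log2 : 0 < Real.log 2 := Real.log_pos one_lt_two
  have h_target : 0 ≤ Real.log 2 * T ^ 2 := by positivity
  have h_var : V ^ 2 * Real.log 2 ≤ 16 * Real.log 2 * T ^ 2 := by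
    nlinarith [pow_le_pow_left₀ (cubeVar_nonneg _) (cubeVar_le col f) 2]
  have hM_nonneg : 0 ≤ M := by positivity
  rcases hM_nonneg.eq_or_lt with hM_zero | hM
  · rw [← hM_zero, div_zero, add_zero, Real.log_one, mul_zero]
    linarith
  rcases (cubeVar_nonneg (boolToReal f)).eq_or_lt with hV_zero | hV
  · rw [show V = 0 from hV_zero.symm, zero_pow two_ne_zero, zero_mul]
    linarith
  have h_core : V ^ 2 * Real.log (V / √M) ≤ 64 * Real.log (2 / (1 / 12)) * T ^ 2 :=
    cubeVar_sq_mul_log_le col f (by norm_num) (by norm_num) (by positivity)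
      (noiseCov_one_twelfth_le_sqrt_sum_influence_sq f)
  have h_log24 : Real.log (2 / (1 / 12)) ≤ 5 * Real.log 2 := by
    rw [show 5 * Real.log 2 = Real.log (2 ^ 5) by rw [Real.log_pow]; norm_num]
    exact Real.log_le_log (by norm_num) (by norm_num)
  rcases le_total 1 M with h_one_le | h_le_one
  · have h_log : Real.log (1 + 1 / M) ≤ Real.log 2 :=
      Real.log_le_log (by positivity) (by linarith [(div_le_one hM).2 h_one_le])
    nlinarith
  · nlinarith [cubeVar_sq_mul_log_one_div_le col f,
      mul_le_mul_of_nonneg_left (log_one_add_one_div_le hV hM h_le_one) (sq_nonneg V),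
      mul_le_mul_of_nonneg_right h_log24 (sq_nonneg T)]

theorem cubeVar_mul_sqrt_log_one_add_one_div_le (col : EdgeColoring n) (f : Cube n → Bool) :
    cubeVar (boolToReal f) * √(Real.log (1 + 1 / ∑ i, influence f i ^ 2)) ≤
      34 * talagrandCol col f := by
  refine mul_sqrt_le_of_sq_mul_le (cubeVar_nonneg _)
    (mul_nonneg (by norm_num) (talagrandCol_nonneg col f)) ?_
  nlinarith [cubeVar_sq_mul_log_one_add_one_div_le col f, Real.log_two_lt_d9,
    sq_nonneg (talagrandCol col f)]

end CubeAnalysis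

theorem mainTheorem7 :
    (∀ (n : ℕ) (f : Cube n → Bool) (col : EdgeColoring n),
      talagrandCol col f ≥ 1 / 2 * Real.sqrt (weightEq 1 (boolToReal f))) ∧
    (∃ c : ℝ, 0 < c ∧ ∀ (n d : ℕ) (f : Cube n → Bool) (col : EdgeColoring n),
      talagrandCol col f ≥ c * (Real.sqrt (d : ℝ) * weightGe d (boolToReal f))) ∧
    (∃ c : ℝ, 0 < c ∧ ∀ (n : ℕ) (f : Cube n → Bool) (col : EdgeColoring n),
      talagrandCol col f ≥
        c * cubeVar (boolToReal f) * Real.sqrt (Real.log (1 / cubeVar (boolToReal f)))) ∧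
    (∃ c : ℝ, 0 < c ∧ ∀ (n : ℕ) (f : Cube n → Bool) (col : EdgeColoring n),
      talagrandCol col f ≥
        c * cubeVar (boolToReal f) *
          Real.sqrt (Real.log (1 + 1 / ∑ i : Fin n, influence f i ^ 2))) := by
  refine ⟨fun n f col => ?_, ⟨1 / 4, by norm_num, fun n d f col => ?_⟩,
    ⟨1 / 18, by norm_num, fun n f col => ?_⟩, ⟨1 / 34, by norm_num, fun n f col => ?_⟩⟩
  · linarith [sqrt_weightEq_one_le_talagrandCol col f, talagrandCol_nonneg col f]
  · linarith [sqrt_mul_weightGe_le col f d]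
  · rw [mul_assoc]
    linarith [cubeVar_mul_sqrt_log_one_div_le col f]
  · rw [mul_assoc]
    linarith [cubeVar_mul_sqrt_log_one_add_one_div_le col f]
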